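/- For a partition $\lambda=(\lambda_1\ge\lambda_2\ge\cdots)$ of $n$ let $\rho_\lambda$ be given by $2\rho_\lambda=\sum_i\lambda_i(\lambda_i-2i+1)$, and let $\chi^\lambda(\nu)$, for partitions $\nu$ of $n$, be the coefficients in the expansion $s_\lambda=\sum_\nu z_\nu^{-1}\chi^\lambda(\nu)\,p_\nu$ of the Schur polynomial in $N\ge n$ variables in terms of power sums, where $z_\nu=\prod_i i^{m_i}m_i!$ and $m_i$ is the number of parts of $\nu$ equal to $i$. In particular, $\chi^\lambda(1^n)$ is the number of standard Young tableaux of shape $\lambda$. Lemma. For integers $0<a$, $0\le b$ with $a+b=n$ denote by $\lambda_{a,b}=a\,1^b$ the partition of $n$ with parts $a,1,\dots,1$ ($b$ ones). For integers $1\le c<a$, $0\le d<b$ with $a+b+c+d=n$ denote by $\lambda_{a,b,c,d}=a\,(c+1)\,2^d\,1^{b-d-1}$ the partition of $n$ with parts $a$, $c+1$, $d$ twos and $b-d-1$ ones. The $\lambda_{a,b}$ are exactly the hooks, that is, the partitions of $n$ whose Young diagram is nonempty and does not contain a $2\times2$ square; the $\lambda_{a,b,c,d}$ are exactly the partitions of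 $n$ whose Young diagram contains a $2\times2$ square but not a $3\times3$ square. For all $a,b,c,d$ with $1\le c<a$, $0\le d<b$ and $a+b+c+d=n$, the number of standard Young tableaux of shape $\lambda_{a,b,c,d}$ and the coefficient $\chi^{\lambda_{a,b,c,d}}(1^n)$ are both equal to \[ \binom{n}{a,b,c,d}\,\frac{a\,c\,(a-c)(b-d)}{(a+b)(a+d)(b+c)(c+d)}, \qquad \binom{n}{a,b,c,d}=\frac{n!}{a!\,b!\,c!\,d!}, \] and \[ \rho_{\lambda_{a,b,c,d}}=\binom a2-\binom{b+1}2+\binom c2-\binom{d+1}2 . \] -/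

import Mathlib

theorem sortedGE_hookRows (a b : ℕ) (h : 0 < a) :
    (a :: List.replicate b 1).SortedGE := by
  rw [List.sortedGE_iff_pairwise, List.pairwise_cons]
  refine ⟨fun x hx => ?_, List.pairwise_replicate.2 (Or.inr le_rfl)⟩
  rw [List.eq_of_mem_replicate hx]
  exact h

theorem sortedGE_doubleHookRows (a b c d : ℕ) (hc : 1 ≤ c) (hca : c < a) :
    (a :: (c + 1) :: (List.replicate d 2 ++ List.replicate (b - d - 1) 1)).SortedGE := by
  rw [List.sortedGE_iff_pairwise, List.pairwise_cons, List.pairwise_cons, List.pairwise_append]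
  refine ⟨fun x hx => ?_, fun x hx => ?_, List.pairwise_replicate.2 (Or.inr le_rfl),
    List.pairwise_replicate.2 (Or.inr le_rfl), fun x hx y hy => ?_⟩
  · simp only [List.mem_cons, List.mem_append, List.mem_replicate] at hx
    omega
  · simp only [List.mem_append, List.mem_replicate] at hx
    omega
  · simp only [List.mem_replicate] at hx hy
    omega

/-- The hook `a 1^b`: one row of length `a`, followed by `b` rows of length `1`. -/
def hookDiagram (a b : ℕ) (h : 0 < a) : YoungDiagram :=
  YoungDiagram.ofRowLens (a :: List.replicate b 1) (sortedGE_hookRows a b h)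

/-- The Young diagram of the partition `a (c+1) 2^d 1^(b-d-1)`, where `1 ≤ c < a` and `0 ≤ d < b`
(so that the subtraction `b - d - 1` of natural numbers does not truncate). -/
def doubleHookDiagram (a b c d : ℕ) (hc : 1 ≤ c) (hca : c < a) (_hdb : d < b) : YoungDiagram :=
  YoungDiagram.ofRowLens
    (a :: (c + 1) :: (List.replicate d 2 ++ List.replicate (b - d - 1) 1))
    (sortedGE_doubleHookRows a b c d hc hca)

/-- Standard Young tableaux of shape `μ`: fillings in which each of `1, …, |μ|` occurs exactly once
and which increase along rows and columns. (Columns of a semistandard tableau increase strictly, rows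
weakly, and the latter is strict as soon as no entry is repeated.) -/
def StandardYoungTableau (μ : YoungDiagram) : Type :=
  {T : SemistandardYoungTableau μ //
    Set.BijOn (fun c : ℕ × ℕ => T c.1 c.2) (μ.cells : Set (ℕ × ℕ)) (Set.Icc 1 μ.card)}

open Classical in
/-- The Schur polynomial `s_μ(x_1, …, x_N)`: the sum of the monomials `∏_{cells} x_{T(cell)}` over all
semistandard Young tableaux `T` of shape `μ` with entries in an alphabet of `N` letters. -/
noncomputable def schurPolynomial (N : ℕ) (μ : YoungDiagram) : MvPolynomial (Fin N) ℚ :=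
  ∑ T : μ.cells → Fin N with
      ∃ S : SemistandardYoungTableau μ, ∀ c : μ.cells, S c.1.1 c.1.2 = (T c : ℕ),
    ∏ c : μ.cells, MvPolynomial.X (T c)

/-- `z_ν = ∏_i i^{m_i} m_i!`, where `m_i` is the number of parts of `ν` equal to `i`. -/
def partitionZ {n : ℕ} (ν : n.Partition) : ℕ :=
  ∏ i ∈ ν.parts.toFinset, i ^ ν.parts.count i * (ν.parts.count i).factorial

/-- The partition `1^n` of `n`. -/
def onesPartition (n : ℕ) : n.Partition where
  parts := Multiset.replicate n 1
  parts_pos := fun h => by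
    rw [Multiset.eq_of_mem_replicate h]
    exact Nat.one_pos
  parts_sum := by simp

/-- `χ` is the system `ν ↦ χ^μ(ν)`, `ν` a partition of `n`, of coefficients of the Schur polynomial
`s_μ` in terms of power sums: `s_μ = ∑_ν z_ν⁻¹ χ^μ(ν) p_ν`, as polynomials in `N` variables.
For `n = |μ| ≤ N` the `p_ν` are linearly independent, so that this determines `χ`. -/
def IsSchurPowerSumCoeff {n : ℕ} (N : ℕ) (μ : YoungDiagram) (χ : n.Partition → ℚ) : Prop :=
  schurPolynomial N μ =
    ∑ ν : n.Partition, (χ ν / (partitionZ ν : ℚ)) • MvPolynomial.psumPart (Fin N) ℚ ν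

/-- `ρ_μ`, given by `2 ρ_μ = ∑_i μ_i (μ_i - 2 i + 1)`, where the rows are numbered `i = 1, 2, …`
(the row with index `i` in Lean is the row number `i + 1`). -/
def youngRho (μ : YoungDiagram) : ℚ :=
  (∑ i ∈ Finset.range (μ.colLen 0),
    (μ.rowLen i : ℚ) * ((μ.rowLen i : ℚ) - 2 * ((i : ℚ) + 1) + 1)) / 2

/-!
Standard Young tableaux of a given shape are the linear extensions of the poset of its cells. The
largest value of a linear extension of a finite poset sits at a maximal element, and removing that
element leaves a linear extension of the rest (`FinLinearExtension.card_eq_sum`). For a double hook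
the maximal elements are among the ends of its two arms and two legs, and removing one of them
decreases one of the parameters `a, b, c, d` by `1`. The number of standard tableaux is thus
determined by a four-term recursion (`doubleHookCount_rec`), and the claimed formula satisfies it:
after division by the multinomial coefficient this is the identity `doubleHookRatio_rec` between
rational functions. Where an end of an arm or leg cannot be removed, the formula for the smaller
parameters gives `0`; the one exception is `c = 1`, `d = 0`, where removing the cell `(1, 1)` leaves
a hook, whose tableaux are counted by a binomial coefficient (`doubleHookCount_hook`).

For `χ^μ(1^n)`, compare the coefficients of `x_1 ⋯ x_n` in `s_μ = ∑_ν z_ν⁻¹ χ^μ(ν) p_ν`. A power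
sum product `p_ν` with some part of `ν` at least `2` has no squarefree monomial, while for `ν = 1^n`
the coefficient in `p_ν = p_1^n` is `n! = z_ν`; on the left the coefficient counts the semistandard
tableaux in which each of the first `n` letters occurs once, and raising the entries by `1` makes
these the standard ones (`IsSchurPowerSumCoeff.apply_onesPartition_eq_card`).

The cells of hooks and double hooks are described by `mem_doubleHookCells`, from which the
classification by the absence of a `2 × 2` or `3 × 3` square and the value of `ρ` follow.
-/

/-! ### Linear extensions of finite posets -/

/-- The linear extensions of a finite subset `s` of a partial order: the strictly increasing
bijections from `s` onto `{1, …, |s|}`, extended by `0` outside `s`. -/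
def FinLinearExtension {α : Type*} [PartialOrder α] (s : Finset α) : Type _ :=
  {g : α → ℕ // (∀ x ∉ s, g x = 0) ∧ Set.BijOn g s (Set.Icc 1 s.card) ∧ StrictMonoOn g s}

namespace FinLinearExtension

variable {α : Type*} [PartialOrder α]

instance finite (s : Finset α) : Finite (FinLinearExtension s) := by
  refine Finite.of_injective
    (fun g x => ⟨g.1 x.1, Nat.lt_succ_of_le (g.2.2.1.mapsTo x.2).2⟩ :
      FinLinearExtension s → s → Fin (s.card + 1)) fun g h hgh => Subtype.ext (funext fun x => ?_)
  by_cases hx : x ∈ s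
  · exact congrArg Fin.val (congrFun hgh ⟨x, hx⟩)
  · rw [g.2.1 x hx, h.2.1 x hx]

theorem card_empty : Nat.card (FinLinearExtension (∅ : Finset α)) = 1 := by
  rw [Nat.card_eq_one_iff_unique]
  refine ⟨⟨fun g h => Subtype.ext (funext fun x => ?_)⟩, ⟨⟨fun _ => 0, ?_, ?_, ?_⟩⟩⟩
  · rw [g.2.1 x (Finset.notMem_empty x), h.2.1 x (Finset.notMem_empty x)]
  · simp
  · simp
  · simp [StrictMonoOn]

variable [DecidableEq α]

/-- The linear extension of `s` that extends one of `s \ {c}`, for a maximal element `c` of `s`,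
by the largest value `|s|` at `c`. -/
def extend {s : Finset α} {c : α} (hc : Maximal (· ∈ s) c) (g : FinLinearExtension (s.erase c)) :
    FinLinearExtension s := by
  have hcs : c ∈ s := hc.prop
  have hcard : (s.erase c).card + 1 = s.card := Finset.card_erase_add_one hcs
  have hle : ∀ x ∈ s, x ≠ c → 1 ≤ g.1 x ∧ g.1 x < s.card := fun x hx hxc => by
    have := g.2.2.1.mapsTo (Finset.mem_coe.2 (Finset.mem_erase.2 ⟨hxc, hx⟩))
    rw [Set.mem_Icc] at this
    omega
  refine ⟨Function.update g.1 c s.card, fun x hx => ?_, ⟨fun x hx => ?_, fun x hx y hy h => ?_,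
    fun k hk => ?_⟩, fun x hx y hy hxy => ?_⟩
  · have hxc : x ≠ c := fun h => hx (h ▸ hcs)
    rw [Function.update_of_ne hxc]
    exact g.2.1 x fun h => hx (Finset.mem_of_mem_erase h)
  · rw [Set.mem_Icc]
    rcases eq_or_ne x c with rfl | hxc
    · rw [Function.update_self]
      omega
    · rw [Function.update_of_ne hxc]
      have := hle x hx hxc
      omega
  · rcases eq_or_ne x c with rfl | hxc <;> rcases eq_or_ne y x with rfl | hyx
    · rfl
    · rw [Function.update_self, Function.update_of_ne hyx] at h
      have := hle y hy hyx
      omega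
    · rfl
    · rcases eq_or_ne y c with rfl | hyc
      · rw [Function.update_self, Function.update_of_ne hxc] at h
        have := hle x hx hxc
        omega
      · rw [Function.update_of_ne hxc, Function.update_of_ne hyc] at h
        exact g.2.2.1.injOn (Finset.mem_erase.2 ⟨hxc, hx⟩) (Finset.mem_erase.2 ⟨hyc, hy⟩) h
  · rw [Set.mem_Icc] at hk
    rcases eq_or_lt_of_le hk.2 with rfl | hlt
    · exact ⟨c, hcs, Function.update_self ..⟩
    · obtain ⟨x, hx, rfl⟩ := g.2.2.1.surjOn (Set.mem_Icc.2 ⟨hk.1, show k ≤ _ by omega⟩)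
      have hx' := Finset.mem_erase.1 hx
      exact ⟨x, hx'.2, Function.update_of_ne hx'.1 ..⟩
  · have hxc : x ≠ c := fun h => (hc.not_prop_of_gt (h ▸ hxy)) hy
    rw [Function.update_of_ne hxc]
    rcases eq_or_ne y c with rfl | hyc
    · rw [Function.update_self]
      exact (hle x hx hxc).2
    · rw [Function.update_of_ne hyc]
      exact g.2.2.2 (Finset.mem_erase.2 ⟨hxc, hx⟩) (Finset.mem_erase.2 ⟨hyc, hy⟩) hxy

/-- Every linear extension takes its largest value at a unique element, which is maximal. -/
theorem bijective_extend {s : Finset α} (hs : s.Nonempty) :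
    Function.Bijective
      (fun p : (Σ c : {c // Maximal (· ∈ s) c}, FinLinearExtension (s.erase c.1)) =>
        extend p.1.2 p.2) := by
  constructor
  · rintro ⟨⟨c, hc⟩, g⟩ ⟨⟨c', hc'⟩, g'⟩ h
    have h' : Function.update g.1 c s.card = Function.update g'.1 c' s.card :=
      congrArg Subtype.val h
    obtain rfl : c = c' := by
      by_contra hne
      have h1 := congrFun h' c
      rw [Function.update_self, Function.update_of_ne hne] at h1
      have h2 := g'.2.2.1.mapsTo (Finset.mem_coe.2 (Finset.mem_erase.2 ⟨hne, hc.prop⟩))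
      rw [← h1, Finset.card_erase_of_mem hc'.prop, Set.mem_Icc] at h2
      omega
    congr 1
    refine Subtype.ext (funext fun x => ?_)
    rcases eq_or_ne x c with rfl | hxc
    · rw [g.2.1 x (Finset.notMem_erase x s), g'.2.1 x (Finset.notMem_erase x s)]
    · simpa [Function.update_of_ne hxc] using congrFun h' x
  · intro g
    obtain ⟨c, hcs, hgc⟩ := g.2.2.1.surjOn (Set.right_mem_Icc.2 hs.card_pos)
    have hcs' : c ∈ s := hcs
    have hcard : (s.erase c).card + 1 = s.card := Finset.card_erase_add_one hcs'
    have hc : Maximal (· ∈ s) c := by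
      refine ⟨hcs', fun y hy hcy => ?_⟩
      by_contra hyc
      have h1 := g.2.2.2 hcs hy (lt_of_le_not_ge hcy hyc)
      have h2 := (g.2.2.1.mapsTo (Finset.mem_coe.2 hy)).2
      omega
    have hrestrict : (∀ x ∉ s.erase c, Function.update g.1 c 0 x = 0) ∧
        Set.BijOn (Function.update g.1 c 0) (s.erase c) (Set.Icc 1 (s.erase c).card) ∧
        StrictMonoOn (Function.update g.1 c 0) (s.erase c) := by
      refine ⟨fun x hx => ?_, ⟨fun x hx => ?_, fun x hx y hy h => ?_, fun k hk => ?_⟩,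
        fun x hx y hy hxy => ?_⟩
      · rcases eq_or_ne x c with rfl | hxc
        · rw [Function.update_self]
        · rw [Function.update_of_ne hxc]
          exact g.2.1 x fun h => hx (Finset.mem_erase.2 ⟨hxc, h⟩)
      · have hx' := Finset.mem_erase.1 hx
        rw [Function.update_of_ne hx'.1]
        have h1 := g.2.2.1.mapsTo (Finset.mem_coe.2 hx'.2)
        have h2 : g.1 x ≠ g.1 c := fun h => hx'.1 (g.2.2.1.injOn hx'.2 hcs h)
        rw [Set.mem_Icc] at h1 ⊢
        omega
      · have hx' := Finset.mem_erase.1 hx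
        have hy' := Finset.mem_erase.1 hy
        rw [Function.update_of_ne hx'.1, Function.update_of_ne hy'.1] at h
        exact g.2.2.1.injOn hx'.2 hy'.2 h
      · rw [Set.mem_Icc] at hk
        obtain ⟨x, hx, hxk⟩ := g.2.2.1.surjOn (Set.mem_Icc.2 ⟨hk.1, show k ≤ _ by omega⟩)
        have hxc : x ≠ c := by
          rintro rfl
          omega
        exact ⟨x, Finset.mem_erase.2 ⟨hxc, hx⟩, by rw [Function.update_of_ne hxc, hxk]⟩
      · have hx' := Finset.mem_erase.1 hx
        have hy' := Finset.mem_erase.1 hy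
        rw [Function.update_of_ne hx'.1, Function.update_of_ne hy'.1]
        exact g.2.2.2 hx'.2 hy'.2 hxy
    refine ⟨⟨⟨c, hc⟩, ⟨Function.update g.1 c 0, hrestrict⟩⟩, Subtype.ext ?_⟩
    exact (Function.update_idem ..).trans
      ((congrArg (Function.update g.1 c) hgc.symm).trans (Function.update_eq_self ..))

open Classical in
/-- The number of linear extensions satisfies the recursion given by removing the element with the
largest value. -/
theorem card_eq_sum {s : Finset α} (hs : s.Nonempty) :
    Nat.card (FinLinearExtension s) =
      ∑ c ∈ s with Maximal (· ∈ s) c, Nat.card (FinLinearExtension (s.erase c)) := by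
  have e : {c // c ∈ s.filter (fun c => Maximal (· ∈ s) c)} ≃ {c // Maximal (· ∈ s) c} :=
    Equiv.subtypeEquivRight fun c => by
      rw [Finset.mem_filter]
      exact ⟨And.right, fun h => ⟨h.prop, h⟩⟩
  have : Fintype {c // Maximal (· ∈ s) c} := Fintype.ofEquiv _ e
  rw [← Nat.card_congr (Equiv.ofBijective _ (bijective_extend hs)), Nat.card_sigma]
  refine (Finset.sum_subtype _ (fun c => ?_)
    (fun c => Nat.card (FinLinearExtension (s.erase c)))).symm
  rw [Finset.mem_filter]
  exact ⟨And.right, fun h => ⟨h.prop, h⟩⟩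

end FinLinearExtension

/-- A standard Young tableau of shape `μ` is a linear extension of the poset of cells of `μ`. -/
def standardYoungTableauEquiv (μ : YoungDiagram) :
    StandardYoungTableau μ ≃ FinLinearExtension μ.cells where
  toFun T := by
    refine ⟨fun c => T.1 c.1 c.2, fun c hc => T.1.zeros hc, T.2, ?_⟩
    rintro ⟨i, j⟩ hx ⟨i', j'⟩ hy hxy
    have hle := Prod.mk_le_mk.1 hxy.le
    have h1 : T.1 i j ≤ T.1 i j' := T.1.row_weak_of_le hle.2 (μ.up_left_mem hle.1 le_rfl hy)
    have h2 : T.1 i j' ≤ T.1 i' j' := T.1.col_weak hle.1 hy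
    refine lt_of_le_of_ne (h1.trans h2) fun h => hxy.ne (T.2.injOn hx hy h)
  invFun g := by
    refine ⟨⟨fun i j => g.1 (i, j), fun {i j j'} hj h => ?_, fun {i i' j} hi h => ?_,
      fun {i j} h => g.2.1 _ h⟩, g.2.2.1⟩
    · exact (g.2.2.2 (μ.up_left_mem le_rfl hj.le h) h (Prod.mk_lt_mk_iff_right.2 hj)).le
    · exact g.2.2.2 (μ.up_left_mem hi.le le_rfl h) h (Prod.mk_lt_mk_iff_left.2 hi)
  left_inv _ := rfl
  right_inv _ := rfl

/-! ### Double hooks as sets of cells -/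

/-- The cells of the double hook `a (c+1) 2^d 1^(b-d-1)`: the two arms (of lengths `a` and `c`) and
the two legs (of lengths `b` and `d`). For `c = d = 0` this is the hook `a 1^b`. -/
def doubleHookCells (a b c d : ℕ) : Finset (ℕ × ℕ) :=
  ({0} ×ˢ Finset.range a) ∪ (Finset.Icc 1 b ×ˢ {0}) ∪
    (({1} ×ˢ Finset.Icc 1 c) ∪ (Finset.Icc 2 (d + 1) ×ˢ {1}))

theorem mem_doubleHookCells {a b c d i j : ℕ} :
    (i, j) ∈ doubleHookCells a b c d ↔
      (i = 0 ∧ j < a) ∨ (1 ≤ i ∧ i ≤ b ∧ j = 0) ∨ (i = 1 ∧ 1 ≤ j ∧ j ≤ c) ∨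
        (2 ≤ i ∧ i ≤ d + 1 ∧ j = 1) := by
  simp only [doubleHookCells, Finset.mem_union, Finset.mem_product, Finset.mem_singleton,
    Finset.mem_range, Finset.mem_Icc]
  omega

theorem card_doubleHookCells (a b c d : ℕ) : (doubleHookCells a b c d).card = a + b + c + d := by
  unfold doubleHookCells
  rw [Finset.card_union_of_disjoint, Finset.card_union_of_disjoint, Finset.card_union_of_disjoint]
  · simp only [Finset.card_product, Finset.card_singleton, Finset.card_range, Nat.card_Icc]
    omega
  all_goals
    rw [Finset.disjoint_left]
    rintro ⟨i, j⟩ h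
    simp only [Finset.mem_union, Finset.mem_product, Finset.mem_singleton,
      Finset.mem_range, Finset.mem_Icc] at h ⊢
    omega

theorem erase_arm_doubleHookCells {a b c d : ℕ} (ha : 0 < a) :
    (doubleHookCells a b c d).erase (0, a - 1) = doubleHookCells (a - 1) b c d := by
  ext ⟨i, j⟩
  rw [Finset.mem_erase, mem_doubleHookCells, mem_doubleHookCells, Ne, Prod.mk_inj]
  omega

theorem erase_leg_doubleHookCells {a b c d : ℕ} (hb : 0 < b) :
    (doubleHookCells a b c d).erase (b, 0) = doubleHookCells a (b - 1) c d := by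
  ext ⟨i, j⟩
  rw [Finset.mem_erase, mem_doubleHookCells, mem_doubleHookCells, Ne, Prod.mk_inj]
  omega

theorem erase_innerArm_doubleHookCells {a b c d : ℕ} (hc : 0 < c) :
    (doubleHookCells a b c d).erase (1, c) = doubleHookCells a b (c - 1) d := by
  ext ⟨i, j⟩
  rw [Finset.mem_erase, mem_doubleHookCells, mem_doubleHookCells, Ne, Prod.mk_inj]
  omega

theorem erase_innerLeg_doubleHookCells {a b c d : ℕ} (hd : 0 < d) :
    (doubleHookCells a b c d).erase (d + 1, 1) = doubleHookCells a b c (d - 1) := by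
  ext ⟨i, j⟩
  rw [Finset.mem_erase, mem_doubleHookCells, mem_doubleHookCells, Ne, Prod.mk_inj]
  omega

theorem maximal_mem_iff_of_isLowerSet {s : Finset (ℕ × ℕ)} (hs : IsLowerSet (s : Set (ℕ × ℕ)))
    {i j : ℕ} :
    Maximal (· ∈ s) (i, j) ↔ (i, j) ∈ s ∧ (i + 1, j) ∉ s ∧ (i, j + 1) ∉ s := by
  refine ⟨fun h => ⟨h.prop, h.not_prop_of_gt (Prod.mk_lt_mk_iff_left.2 i.lt_succ_self),
    h.not_prop_of_gt (Prod.mk_lt_mk_iff_right.2 j.lt_succ_self)⟩, fun h => ⟨h.1, ?_⟩⟩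
  rintro ⟨i', j'⟩ hy hle
  rw [Prod.mk_le_mk] at hle ⊢
  by_contra hlt
  rcases Nat.lt_or_ge i i' with hi | hi
  · exact h.2.1 (hs (Prod.mk_le_mk.2 ⟨hi, hle.2⟩) hy)
  · exact h.2.2 (hs (Prod.mk_le_mk.2 ⟨hle.1, show j + 1 ≤ j' by omega⟩) hy)

theorem isLowerSet_doubleHookCells {a b c d : ℕ} (hc : 1 ≤ c) (hca : c < a) (hdb : d < b) :
    IsLowerSet (doubleHookCells a b c d : Set (ℕ × ℕ)) := by
  rintro ⟨i, j⟩ ⟨i', j'⟩ hle h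
  rw [Prod.mk_le_mk] at hle
  rw [Finset.mem_coe, mem_doubleHookCells] at h ⊢
  omega

theorem isLowerSet_hookCells {a b : ℕ} (ha : 0 < a) :
    IsLowerSet (doubleHookCells a b 0 0 : Set (ℕ × ℕ)) := by
  rintro ⟨i, j⟩ ⟨i', j'⟩ hle h
  rw [Prod.mk_le_mk] at hle
  rw [Finset.mem_coe, mem_doubleHookCells] at h ⊢
  omega

theorem mem_ite_singleton {α : Type*} {p : Prop} [Decidable p] {x y : α} :
    y ∈ (if p then {x} else ∅ : Finset α) ↔ p ∧ y = x := by
  split_ifs with h <;> simp [h]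

theorem sum_ite_singleton {α : Type*} (p : Prop) [Decidable p] (x : α) (f : α → ℕ) :
    ∑ y ∈ (if p then {x} else ∅ : Finset α), f y = if p then f x else 0 := by
  split_ifs <;> simp

open Classical in
theorem filter_maximal_hookCells {a b : ℕ} (ha : 0 < a) (hab : 1 < a + b) :
    (doubleHookCells a b 0 0).filter (Maximal (· ∈ doubleHookCells a b 0 0)) =
      (if 1 < a then {(0, a - 1)} else ∅) ∪ (if 0 < b then {(b, 0)} else ∅) := by
  ext ⟨i, j⟩
  rw [Finset.mem_filter, maximal_mem_iff_of_isLowerSet (isLowerSet_hookCells ha)]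
  simp only [Finset.mem_union, mem_ite_singleton, mem_doubleHookCells, Prod.mk_inj]
  constructor
  · rintro ⟨-, h | h | h | h, h1, h2⟩ <;> omega
  · rintro (h | h) <;> omega

open Classical in
/-- The corners of a double hook. The inner arm and the inner leg share the cell `(1, 1)`, whence
the conditions on the last two corners. -/
theorem filter_maximal_doubleHookCells {a b c d : ℕ} (hc : 1 ≤ c) (hca : c < a) (hdb : d < b) :
    (doubleHookCells a b c d).filter (Maximal (· ∈ doubleHookCells a b c d)) =
      ((if c + 1 < a then {(0, a - 1)} else ∅) ∪ (if d + 1 < b then {(b, 0)} else ∅)) ∪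
        ((if 2 ≤ c ∨ d = 0 then {(1, c)} else ∅) ∪ (if 0 < d then {(d + 1, 1)} else ∅)) := by
  ext ⟨i, j⟩
  rw [Finset.mem_filter, maximal_mem_iff_of_isLowerSet (isLowerSet_doubleHookCells hc hca hdb)]
  simp only [Finset.mem_union, mem_ite_singleton, mem_doubleHookCells, Prod.mk_inj]
  constructor
  · rintro ⟨-, h | h | h | h, h1, h2⟩ <;> omega
  · rintro ((⟨h, rfl, rfl⟩ | ⟨h, rfl, rfl⟩) | (⟨h, rfl, rfl⟩ | ⟨h, rfl, rfl⟩)) <;>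
      refine ⟨?_, ?_, ?_, ?_⟩ <;> omega

/-- The number of linear extensions of the set of cells of a double hook. -/
noncomputable def doubleHookCount (a b c d : ℕ) : ℕ :=
  Nat.card (FinLinearExtension (doubleHookCells a b c d))

theorem doubleHookCount_hook_rec {a b : ℕ} (ha : 0 < a) (hab : 1 < a + b) :
    doubleHookCount a b 0 0 =
      (if 1 < a then doubleHookCount (a - 1) b 0 0 else 0) +
        (if 0 < b then doubleHookCount a (b - 1) 0 0 else 0) := by
  have hs : (doubleHookCells a b 0 0).Nonempty := ⟨(0, 0), mem_doubleHookCells.2 (by omega)⟩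
  rw [doubleHookCount, FinLinearExtension.card_eq_sum hs, filter_maximal_hookCells ha hab,
    Finset.sum_union, sum_ite_singleton, sum_ite_singleton]
  · congr 1
    · rw [erase_arm_doubleHookCells ha, doubleHookCount]
    · refine ite_congr rfl (fun h => ?_) fun _ => rfl
      rw [erase_leg_doubleHookCells h, doubleHookCount]
  · rw [Finset.disjoint_left]
    rintro ⟨i, j⟩
    simp only [mem_ite_singleton, Prod.mk_inj]
    omega

theorem doubleHookCount_rec {a b c d : ℕ} (hc : 1 ≤ c) (hca : c < a) (hdb : d < b) :
    doubleHookCount a b c d =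
      ((if c + 1 < a then doubleHookCount (a - 1) b c d else 0) +
        (if d + 1 < b then doubleHookCount a (b - 1) c d else 0)) +
      ((if 2 ≤ c ∨ d = 0 then doubleHookCount a b (c - 1) d else 0) +
        (if 0 < d then doubleHookCount a b c (d - 1) else 0)) := by
  have hs : (doubleHookCells a b c d).Nonempty := ⟨(0, 0), mem_doubleHookCells.2 (by omega)⟩
  rw [doubleHookCount, FinLinearExtension.card_eq_sum hs, filter_maximal_doubleHookCells hc hca hdb,
    Finset.sum_union, Finset.sum_union, Finset.sum_union, sum_ite_singleton, sum_ite_singleton,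
    sum_ite_singleton, sum_ite_singleton]
  · congr 2
    · rw [erase_arm_doubleHookCells (by omega), doubleHookCount]
    · rw [erase_leg_doubleHookCells (by omega), doubleHookCount]
    · rw [erase_innerArm_doubleHookCells hc, doubleHookCount]
    · refine ite_congr rfl (fun h => ?_) fun _ => rfl
      rw [erase_innerLeg_doubleHookCells h, doubleHookCount]
  all_goals
    rw [Finset.disjoint_left]
    rintro ⟨i, j⟩
    simp only [Finset.mem_union, mem_ite_singleton, Prod.mk_inj]
    omega

/-! ### Counting linear extensions of double hooks -/

theorem doubleHookCount_hook (a b : ℕ) : doubleHookCount (a + 1) b 0 0 = (a + b).choose b := by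
  induction h : a + b generalizing a b with
  | zero =>
    obtain ⟨rfl, rfl⟩ : a = 0 ∧ b = 0 := by omega
    have h1 : doubleHookCells 1 0 0 0 = {(0, 0)} := rfl
    rw [doubleHookCount, h1, FinLinearExtension.card_eq_sum (Finset.singleton_nonempty _)]
    simp [Finset.filter_singleton, FinLinearExtension.card_empty]
  | succ m ih =>
    rw [doubleHookCount_hook_rec a.succ_pos (by omega)]
    rcases a with _ | a <;> rcases b with _ | b
    · omega
    · obtain rfl : b = m := by omega
      simpa using ih 0 b (by omega)
    · obtain rfl : a = m := by omega
      simpa using ih a 0 (by omega)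
    · have h1 := ih a (b + 1) (by omega)
      have h2 := ih (a + 1) b (by omega)
      simp [h1, h2, Nat.choose_succ_succ, Nat.add_comm (m.choose b)]

/-- The rational factor in the formula for the number of standard tableaux of a double hook. -/
def doubleHookRatio (a b c d : ℚ) : ℚ :=
  (a * c * (a - c) * (b - d)) / ((a + b) * (a + d) * (b + c) * (c + d))

/-- The recursion for double hooks, after division by the multinomial coefficient. -/
theorem doubleHookRatio_rec {a b c d : ℚ} (h1 : a + b ≠ 0) (h2 : a + d ≠ 0) (h3 : b + c ≠ 0)
    (h4 : c + d ≠ 0) (h1' : a + b - 1 ≠ 0) (h2' : a + d - 1 ≠ 0) (h3' : b + c - 1 ≠ 0)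
    (h4' : c + d - 1 ≠ 0) :
    a * doubleHookRatio (a - 1) b c d + b * doubleHookRatio a (b - 1) c d +
      (c * doubleHookRatio a b (c - 1) d + d * doubleHookRatio a b c (d - 1)) =
    (a + b + c + d) * doubleHookRatio a b c d := by
  unfold doubleHookRatio
  rw [show a - 1 + b = a + b - 1 by ring, show a - 1 + d = a + d - 1 by ring,
    show a + (b - 1) = a + b - 1 by ring, show b - 1 + c = b + c - 1 by ring,
    show b + (c - 1) = b + c - 1 by ring, show c - 1 + d = c + d - 1 by ring,
    show a + (d - 1) = a + d - 1 by ring, show c + (d - 1) = c + d - 1 by ring]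
  field_simp
  ring

theorem factorial_pred_mul_ratio {m n : ℕ} (hm : 0 < m) (hn : 0 < n) (X r : ℚ) :
    ((n - 1).factorial : ℚ) / ((m - 1).factorial * X) * r =
      (n.factorial : ℚ) / (m.factorial * X) / n * (m * r) := by
  obtain ⟨m, rfl⟩ := Nat.exists_eq_succ_of_ne_zero hm.ne'
  obtain ⟨n, rfl⟩ := Nat.exists_eq_succ_of_ne_zero hn.ne'
  simp only [Nat.succ_eq_add_one, Nat.add_sub_cancel, Nat.factorial_succ, Nat.cast_mul]
  have h1 : ((m + 1 : ℕ) : ℚ) ≠ 0 := Nat.cast_ne_zero.2 m.succ_ne_zero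
  have h2 : ((n + 1 : ℕ) : ℚ) ≠ 0 := Nat.cast_ne_zero.2 n.succ_ne_zero
  have h3 : (m.factorial : ℚ) ≠ 0 := Nat.cast_ne_zero.2 m.factorial_ne_zero
  rcases eq_or_ne X 0 with rfl | hX
  · simp
  field_simp

/-- The number of linear extensions of a double hook. The recursion of `doubleHookCount_rec` turns
into `doubleHookRatio_rec`, since the ratio vanishes wherever a cell cannot be removed, except that
for `c = 1`, `d = 0` the removal of the cell `(1, 1)` leaves a hook. -/
theorem doubleHookCount_eq {a b c d : ℕ} (hc : 1 ≤ c) (hca : c < a) (hdb : d < b) :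
    (doubleHookCount a b c d : ℚ) =
      ((a + b + c + d).factorial : ℚ) /
        (a.factorial * b.factorial * c.factorial * d.factorial) * doubleHookRatio a b c d := by
  induction h : a + b + c + d using Nat.strong_induction_on generalizing a b c d with
  | _ n ih =>
  have hn : 0 < n := by omega
  have hnQ : (n : ℚ) = a + b + c + d := by rw [← h]; push_cast; rfl
  set M : ℚ := (n.factorial : ℚ) / (a.factorial * b.factorial * c.factorial * d.factorial) with hM
  have hA : ((if c + 1 < a then doubleHookCount (a - 1) b c d else 0 : ℕ) : ℚ) =
      M / n * (a * doubleHookRatio (a - 1) b c d) := by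
    split_ifs with hlt
    · rw [ih (n - 1) (by omega) hc (by omega) hdb (by omega), hM]
      have := factorial_pred_mul_ratio (m := a) (by omega) hn
        (b.factorial * c.factorial * d.factorial) (doubleHookRatio (a - 1) b c d)
      rw [Nat.cast_pred (by omega)]
      simpa only [mul_assoc] using this
    · have : (a : ℚ) - 1 = c := by
        rw [show a = c + 1 by omega]; push_cast; ring
      simp [doubleHookRatio, this]
  have hB : ((if d + 1 < b then doubleHookCount a (b - 1) c d else 0 : ℕ) : ℚ) =
      M / n * (b * doubleHookRatio a (b - 1) c d) := by
    split_ifs with hlt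
    · rw [ih (n - 1) (by omega) hc hca (by omega) (by omega), hM]
      have := factorial_pred_mul_ratio (m := b) (by omega) hn
        (a.factorial * c.factorial * d.factorial) (doubleHookRatio a (b - 1) c d)
      rw [Nat.cast_pred (by omega)]
      simpa only [mul_assoc, mul_left_comm] using this
    · have : (b : ℚ) - 1 = d := by
        rw [show b = d + 1 by omega]; push_cast; ring
      simp [doubleHookRatio, this]
  have hD : ((if 0 < d then doubleHookCount a b c (d - 1) else 0 : ℕ) : ℚ) =
      M / n * (d * doubleHookRatio a b c (d - 1)) := by
    split_ifs with hlt
    · rw [ih (n - 1) (by omega) hc hca (by omega) (by omega), hM]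
      have := factorial_pred_mul_ratio (m := d) (by omega) hn
        (a.factorial * b.factorial * c.factorial) (doubleHookRatio a b c (d - 1))
      rw [Nat.cast_pred (by omega)]
      simpa only [mul_assoc, mul_left_comm, mul_comm] using this
    · simp [show d = 0 by omega]
  have ha' : (2 : ℚ) ≤ a := by exact_mod_cast (by omega : 2 ≤ a)
  have hb' : (1 : ℚ) ≤ b := by exact_mod_cast (by omega : 1 ≤ b)
  have hc' : (1 : ℚ) ≤ c := by exact_mod_cast hc
  have hd' : (0 : ℚ) ≤ d := d.cast_nonneg
  rw [doubleHookCount_rec hc hca hdb, Nat.cast_add, Nat.cast_add, Nat.cast_add, hA, hB, hD]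
  have hn0 : (n : ℚ) ≠ 0 := by positivity
  by_cases hcd : c = 1 ∧ d = 0
  · obtain ⟨rfl, rfl⟩ := hcd
    obtain ⟨a, rfl⟩ : ∃ k, a = k + 1 := ⟨a - 1, by omega⟩
    obtain ⟨b, rfl⟩ : ∃ k, b = k + 1 := ⟨b - 1, by omega⟩
    obtain rfl : n = a + b + 2 + 1 := by omega
    -- `M / n` times `(a + 1) / (a + b + 2)`, as `n! / n = (a + b + 2)!`
    have hh : ((a + (b + 1)).choose (b + 1) : ℚ) =
        M / (a + b + 2 + 1 : ℕ) * (((a : ℚ) + 1) / (a + b + 2)) := by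
      rw [Nat.cast_choose ℚ (Nat.le_add_left ..), Nat.add_sub_cancel, hM,
        show a + b + 2 = (a + (b + 1)) + 1 by ring, Nat.factorial_succ (a + (b + 1) + 1),
        Nat.factorial_succ (a + (b + 1)), Nat.factorial_succ a]
      push_cast
      have h1 : ((a.factorial : ℕ) : ℚ) ≠ 0 := Nat.cast_ne_zero.2 a.factorial_ne_zero
      have h2 : (((b + 1).factorial : ℕ) : ℚ) ≠ 0 := Nat.cast_ne_zero.2 (b + 1).factorial_ne_zero
      have h3 : (a : ℚ) + (b + 1) + 1 + 1 ≠ 0 := by positivity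
      have h4 : (a : ℚ) + (b + 1) + 1 ≠ 0 := by positivity
      have h5 : (a : ℚ) + b + 2 ≠ 0 := by positivity
      simp only [Nat.factorial_one, Nat.factorial_zero, Nat.cast_one, mul_one]
      field_simp
      ring
    rw [if_pos (Or.inr rfl), Nat.sub_self, doubleHookCount_hook, hh, ← mul_add, ← mul_add,
      ← mul_add]
    have hR : ((a + 1 : ℕ) : ℚ) * doubleHookRatio ((a + 1 : ℕ) - 1) (b + 1 : ℕ) (1 : ℕ) (0 : ℕ) +
        ((b + 1 : ℕ) : ℚ) * doubleHookRatio (a + 1 : ℕ) ((b + 1 : ℕ) - 1) (1 : ℕ) (0 : ℕ) +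
        (((a : ℚ) + 1) / (a + b + 2) +
          ((0 : ℕ) : ℚ) * doubleHookRatio (a + 1 : ℕ) (b + 1 : ℕ) (1 : ℕ) ((0 : ℕ) - 1)) =
        ((a + b + 2 + 1 : ℕ) : ℚ) *
          doubleHookRatio (a + 1 : ℕ) (b + 1 : ℕ) (1 : ℕ) (0 : ℕ) := by
      have h5 : (a : ℚ) ≠ 0 := by
        push_cast at ha'
        linarith
      have h1 : (a : ℚ) + b + 2 ≠ 0 := by positivity
      have h2 : (a : ℚ) + b + 1 ≠ 0 := by positivity
      have h3 : (a : ℚ) + 1 ≠ 0 := by positivity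
      have h4 : (b : ℚ) + 1 ≠ 0 := by positivity
      have h6 : (b : ℚ) + 2 ≠ 0 := by positivity
      unfold doubleHookRatio
      push_cast
      rw [show (a : ℚ) + 1 - 1 + (b + 1) = a + b + 1 by ring, show (a : ℚ) + 1 - 1 + 0 = a by ring,
        show (a : ℚ) + 1 + (b + 1 - 1) = a + b + 1 by ring,
        show (b : ℚ) + 1 - 1 + 1 = b + 1 by ring,
        show (a : ℚ) + 1 + (b + 1) = a + b + 2 by ring, show (b : ℚ) + 1 + 1 = b + 2 by ring]
      field_simp
      ring
    rw [hR]
    field_simp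
  · have hC : ((if 2 ≤ c ∨ d = 0 then doubleHookCount a b (c - 1) d else 0 : ℕ) : ℚ) =
        M / n * (c * doubleHookRatio a b (c - 1) d) := by
      split_ifs with hlt
      · rw [ih (n - 1) (by omega) (by omega) (by omega) hdb (by omega), hM]
        have := factorial_pred_mul_ratio (m := c) (by omega) hn
          (a.factorial * b.factorial * d.factorial) (doubleHookRatio a b (c - 1) d)
        rw [Nat.cast_pred (by omega)]
        simpa only [mul_assoc, mul_left_comm] using this
      · simp [doubleHookRatio, show c = 1 by omega]
    have hcd' : (2 : ℚ) ≤ c + d := by exact_mod_cast (by omega : 2 ≤ c + d)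
    rw [hC, ← mul_add, ← mul_add, ← mul_add, doubleHookRatio_rec, ← hnQ]
    · field_simp
    all_goals
      refine ne_of_gt ?_
      linarith

/-! ### The coefficient of a squarefree monomial -/

section

open MvPolynomial

theorem coeff_prod_X {σ ι : Type*} [Fintype ι] [DecidableEq σ] (f : ι → σ) (m : σ →₀ ℕ) :
    coeff m (∏ c, X (f c) : MvPolynomial σ ℚ) =
      if ∑ c, Finsupp.single (f c) 1 = m then 1 else 0 := by
  have : (∏ c, X (f c) : MvPolynomial σ ℚ) = monomial (∑ c, Finsupp.single (f c) 1) 1 := by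
    rw [monomial_sum_one]
    rfl
  rw [this, coeff_monomial]

/-- The exponent of the squarefree monomial `∏ i ∈ s, x_i`. -/
noncomputable def squarefreeExponent {σ : Type*} [DecidableEq σ] (s : Finset σ) : σ →₀ ℕ :=
  ∑ i ∈ s, Finsupp.single i 1

theorem squarefreeExponent_apply {σ : Type*} [DecidableEq σ] (s : Finset σ) (i : σ) :
    squarefreeExponent s i = if i ∈ s then 1 else 0 := by
  simp [squarefreeExponent, Finsupp.finsetSum_apply, Finsupp.single_apply]

theorem coeff_squarefree_psum_mul {σ : Type*} [Fintype σ] [DecidableEq σ] (s : Finset σ) {k : ℕ}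
    (hk : 2 ≤ k) (p : MvPolynomial σ ℚ) :
    coeff (squarefreeExponent s) (psum σ ℚ k * p) = 0 := by
  rw [psum, Finset.sum_mul, coeff_sum]
  refine Finset.sum_eq_zero fun i _ => ?_
  rw [X_pow_eq_monomial, coeff_monomial_mul', if_neg]
  intro h
  have := h i
  rw [Finsupp.single_eq_same, squarefreeExponent_apply] at this
  split_ifs at this <;> omega

theorem coeff_squarefree_psum_one_pow {σ : Type*} [Fintype σ] [DecidableEq σ] (n : ℕ)
    (s : Finset σ) (hs : s.card = n) :
    coeff (squarefreeExponent s) (psum σ ℚ 1 ^ n) = n.factorial := by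
  induction n generalizing s with
  | zero =>
    rw [Finset.card_eq_zero.1 hs]
    simp [squarefreeExponent]
  | succ n ih =>
    rw [pow_succ', psum, Finset.sum_mul, coeff_sum]
    have h : ∀ i : σ, coeff (squarefreeExponent s) (X i ^ 1 * (∑ i : σ, X i ^ 1) ^ n) =
        if i ∈ s then (n.factorial : ℚ) else 0 := fun i => by
      rw [pow_one, coeff_X_mul']
      refine ite_congr ?_ (fun hi => ?_) fun _ => rfl
      · simp [squarefreeExponent_apply]
      · rw [← ih (s.erase i) (by rw [Finset.card_erase_of_mem hi, hs, Nat.add_sub_cancel]), psum]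
        congr 1
        rw [squarefreeExponent, ← Finset.add_sum_erase s _ hi, add_tsub_cancel_left,
          squarefreeExponent]
    rw [Finset.sum_congr rfl fun i _ => h i, Finset.sum_ite_mem, Finset.univ_inter,
      Finset.sum_const, hs, nsmul_eq_mul, Nat.factorial_succ, Nat.cast_mul]

theorem exists_two_le_of_ne_onesPartition {n : ℕ} {ν : n.Partition} (hν : ν ≠ onesPartition n) :
    ∃ k ∈ ν.parts, 2 ≤ k := by
  by_contra! h
  refine hν (Nat.Partition.ext ?_)
  have h1 : ∀ k ∈ ν.parts, k = 1 := fun k hk => by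
    have := ν.parts_pos hk
    have := h k hk
    omega
  have h2 := Multiset.eq_replicate_card.2 h1
  have h3 := ν.parts_sum
  rw [h2, Multiset.sum_replicate, smul_eq_mul, mul_one] at h3
  rw [h2, h3]
  rfl

theorem partitionZ_onesPartition (n : ℕ) : partitionZ (onesPartition n) = n.factorial := by
  rcases Nat.eq_zero_or_pos n with rfl | hn
  · simp [partitionZ, onesPartition]
  · simp [partitionZ, onesPartition, Multiset.toFinset_replicate, hn.ne']

/-- A squarefree monomial of degree `n` occurs in `p_ν`, for a partition `ν` of `n`, only if
`ν = 1^n`. -/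
theorem coeff_squarefree_psumPart {σ : Type*} [Fintype σ] [DecidableEq σ] {n : ℕ}
    (ν : n.Partition) (s : Finset σ) (hs : s.card = n) :
    coeff (squarefreeExponent s) (psumPart σ ℚ ν) =
      if ν = onesPartition n then (n.factorial : ℚ) else 0 := by
  split_ifs with h
  · rw [h, psumPart, onesPartition, Multiset.map_replicate, Multiset.prod_replicate,
      coeff_squarefree_psum_one_pow n s hs]
  · obtain ⟨k, hk, hk2⟩ := exists_two_le_of_ne_onesPartition h
    rw [psumPart, ← Multiset.cons_erase hk, Multiset.map_cons, Multiset.prod_cons,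
      coeff_squarefree_psum_mul s hk2]

/-- For `s_μ = ∑_ν z_ν⁻¹ χ(ν) p_ν`, compare the coefficients of a squarefree monomial of degree `n`:
on the right only `ν = 1^n` contributes, by `n! / z_ν = 1`. -/
theorem IsSchurPowerSumCoeff.apply_onesPartition {n N : ℕ} {μ : YoungDiagram}
    {χ : n.Partition → ℚ} (hχ : IsSchurPowerSumCoeff N μ χ) (s : Finset (Fin N))
    (hs : s.card = n) :
    χ (onesPartition n) = coeff (squarefreeExponent s) (schurPolynomial N μ) := by
  have hn : (n.factorial : ℚ) ≠ 0 := Nat.cast_ne_zero.2 n.factorial_ne_zero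
  rw [hχ, coeff_sum]
  simp only [coeff_smul, coeff_squarefree_psumPart _ s hs, smul_eq_mul, mul_ite, mul_zero]
  rw [Finset.sum_ite_eq' Finset.univ, if_pos (Finset.mem_univ _), partitionZ_onesPartition,
    div_mul_cancel₀ _ hn]

/-- The initial segment `{0, …, n - 1}` of the alphabet. -/
def initialLetters (N n : ℕ) : Finset (Fin N) :=
  Finset.univ.filter fun i => (i : ℕ) < n

theorem card_initialLetters {N n : ℕ} (h : n ≤ N) : (initialLetters N n).card = n := by
  rw [initialLetters, Fin.card_filter_val_lt, min_eq_right h]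

theorem sum_single_eq_squarefreeExponent_iff {σ ι : Type*} [Fintype ι] [DecidableEq σ]
    (f : ι → σ) (s : Finset σ) :
    ∑ c, Finsupp.single (f c) 1 = squarefreeExponent s ↔ Set.BijOn f Set.univ s := by
  classical
  have happ : ∀ i, (∑ c, Finsupp.single (f c) 1 : σ →₀ ℕ) i =
      (Finset.univ.filter fun c => f c = i).card := fun i => by
    rw [Finsupp.finsetSum_apply, Finset.card_filter]
    exact Finset.sum_congr rfl fun c _ => Finsupp.single_apply
  constructor
  · intro h
    have h' : ∀ i, (Finset.univ.filter fun c => f c = i).card = if i ∈ s then 1 else 0 := by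
      intro i
      rw [← happ, h, squarefreeExponent_apply]
    refine ⟨fun c _ => ?_, fun c _ c' _ hcc => ?_, fun i hi => ?_⟩
    · by_contra hc
      have := h' (f c)
      rw [if_neg (Finset.mem_coe.not.1 hc), Finset.card_eq_zero] at this
      exact Finset.notMem_empty c (this ▸ Finset.mem_filter.2 ⟨Finset.mem_univ _, rfl⟩)
    · refine Finset.card_le_one.1 ((h' (f c')).le.trans ?_) c (by simp [hcc]) c' (by simp)
      split_ifs <;> omega
    · have := h' i
      rw [if_pos (Finset.mem_coe.1 hi)] at this
      obtain ⟨c, hc⟩ := Finset.card_pos.1 (this ▸ Nat.one_pos)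
      exact ⟨c, trivial, (Finset.mem_filter.1 hc).2⟩
  · intro h
    ext i
    rw [happ, squarefreeExponent_apply]
    split_ifs with hi
    · obtain ⟨c, -, rfl⟩ := h.surjOn hi
      refine Finset.card_eq_one.2 ⟨c, ?_⟩
      ext c'
      simpa using ⟨fun hc => h.injOn trivial trivial hc, fun hc => hc ▸ rfl⟩
    · refine Finset.card_eq_zero.2 (Finset.filter_eq_empty_iff.2 fun c _ hc => hi ?_)
      exact hc ▸ h.mapsTo trivial

/-- The fillings counted by the coefficient of `x_1 ⋯ x_n` in the Schur polynomial `s_μ`. -/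
def squarefreeFillings (N : ℕ) (μ : YoungDiagram) : Set (μ.cells → Fin N) :=
  {T | (∃ S : SemistandardYoungTableau μ, ∀ c : μ.cells, S c.1.1 c.1.2 = (T c : ℕ)) ∧
    Set.BijOn T Set.univ (initialLetters N μ.card)}

open Classical in
theorem coeff_schurPolynomial (N : ℕ) (μ : YoungDiagram) :
    coeff (squarefreeExponent (initialLetters N μ.card)) (schurPolynomial N μ) =
      Nat.card (squarefreeFillings N μ) := by
  rw [schurPolynomial, coeff_sum]
  simp only [coeff_prod_X]
  rw [← Finset.sum_filter, Finset.filter_filter, Finset.sum_const, nsmul_eq_mul, mul_one,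
    Nat.card_eq_fintype_card, Fintype.card_subtype]
  simp only [sum_single_eq_squarefreeExponent_iff]
  congr 2
  ext T
  simp only [Finset.mem_filter, Finset.mem_univ, true_and]
  rfl

/-- Raising all entries by `1` turns the fillings of `μ` with each of the entries `0, …, |μ| - 1`
occurring once into the standard tableaux of shape `μ`. -/
theorem card_squarefreeFillings {N : ℕ} {μ : YoungDiagram} (h : μ.card ≤ N) :
    Nat.card (squarefreeFillings N μ) = Nat.card (StandardYoungTableau μ) := by
  have hval : ∀ (T : StandardYoungTableau μ) (c : μ.cells),
      1 ≤ T.1 c.1.1 c.1.2 ∧ T.1 c.1.1 c.1.2 ≤ μ.card := fun T c =>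
    Set.mem_Icc.1 (T.2.mapsTo c.2)
  let F : StandardYoungTableau μ → μ.cells → Fin N := fun T c =>
    ⟨T.1 c.1.1 c.1.2 - 1, by have := hval T c; omega⟩
  have hF : ∀ T, F T ∈ squarefreeFillings N μ := fun T => by
    refine ⟨⟨⟨fun i j => T.1 i j - 1, fun {i j j'} hj hc => ?_, fun {i i' j} hi hc => ?_,
      fun {i j} hc => ?_⟩, fun c => rfl⟩, fun c _ => ?_, fun c _ c' _ hcc => ?_, fun k hk => ?_⟩
    · exact Nat.sub_le_sub_right (T.1.row_weak hj hc) 1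
    · have h1 := hval T ⟨(i, j), μ.up_left_mem hi.le le_rfl hc⟩
      have h2 := T.1.col_strict hi hc
      dsimp only at h1 ⊢
      omega
    · rw [T.1.zeros hc]
    · have := hval T c
      simp only [initialLetters, Finset.coe_filter, Finset.mem_univ, true_and, Set.mem_ofPred_eq, F]
      omega
    · have h1 := hval T c
      have h2 := hval T c'
      have h3 := congrArg Fin.val hcc
      dsimp only [F] at h3
      exact Subtype.ext (T.2.injOn c.2 c'.2 (show T.1 _ _ = T.1 _ _ by omega))
    · have hk' : (k : ℕ) < μ.card := by simpa [initialLetters] using hk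
      obtain ⟨c, hc, hck⟩ := T.2.surjOn (Set.mem_Icc.2 ⟨Nat.le_add_left 1 k, hk'⟩)
      refine ⟨⟨c, hc⟩, trivial, Fin.ext ?_⟩
      dsimp only [F] at hck ⊢
      omega
  refine (Nat.card_congr (Equiv.ofBijective (fun T => ⟨F T, hF T⟩) ⟨fun T T' hTT => ?_, ?_⟩)).symm
  · have hTT' : F T = F T' := congrArg Subtype.val hTT
    refine Subtype.ext (SemistandardYoungTableau.ext fun i j => ?_)
    by_cases hc : (i, j) ∈ μ
    · have h1 := hval T ⟨(i, j), hc⟩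
      have h2 := hval T' ⟨(i, j), hc⟩
      have h3 := congrArg Fin.val (congrFun hTT' ⟨(i, j), hc⟩)
      dsimp only [F] at h1 h2 h3
      omega
    · rw [T.1.zeros hc, T'.1.zeros hc]
  · rintro ⟨f, ⟨S, hS⟩, hf⟩
    have hS1 : ∀ {i j}, (i, j) ∈ μ → (if (i, j) ∈ μ then S i j + 1 else 0) = S i j + 1 :=
      fun h => if_pos h
    refine ⟨⟨⟨fun i j => if (i, j) ∈ μ then S i j + 1 else 0, fun {i j j'} hj hc => ?_,
      fun {i i' j} hi hc => ?_, fun {i j} hc => if_neg hc⟩, fun c hc => ?_,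
      fun c hc c' hc' hcc => ?_, fun k hk => ?_⟩, Subtype.ext (funext fun c => Fin.ext ?_)⟩
    · rw [hS1 hc, hS1 (μ.up_left_mem le_rfl hj.le hc)]
      exact Nat.succ_le_succ (S.row_weak hj hc)
    · rw [hS1 hc, hS1 (μ.up_left_mem hi.le le_rfl hc)]
      exact Nat.succ_lt_succ (S.col_strict hi hc)
    · have h1 := hf.mapsTo (Set.mem_univ ⟨c, hc⟩)
      have h2 := hS ⟨c, hc⟩
      simp only [initialLetters, Finset.coe_filter, Finset.mem_univ, true_and,
        Set.mem_ofPred_eq] at h1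
      refine Set.mem_Icc.2 ?_
      change 1 ≤ (if (c.1, c.2) ∈ μ then S c.1 c.2 + 1 else 0) ∧
        (if (c.1, c.2) ∈ μ then S c.1 c.2 + 1 else 0) ≤ μ.card
      rw [hS1 hc]
      dsimp only at h2
      omega
    · change (if (c.1, c.2) ∈ μ then S c.1 c.2 + 1 else 0) =
        (if (c'.1, c'.2) ∈ μ then S c'.1 c'.2 + 1 else 0) at hcc
      rw [hS1 hc, hS1 hc'] at hcc
      have h1 := hS ⟨c, hc⟩
      have h2 := hS ⟨c', hc'⟩
      have h3 : f ⟨c, hc⟩ = f ⟨c', hc'⟩ := Fin.ext (by dsimp only at h1 h2; omega)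
      exact congrArg Subtype.val (hf.injOn trivial trivial h3)
    · rw [Set.mem_Icc] at hk
      obtain ⟨c, -, hck⟩ := hf.surjOn (show (⟨k - 1, by omega⟩ : Fin N) ∈ _ by
        simp only [initialLetters, Finset.coe_filter, Finset.mem_univ, true_and, Set.mem_ofPred_eq]
        omega)
      refine ⟨c.1, c.2, ?_⟩
      change (if (c.1.1, c.1.2) ∈ μ then S c.1.1 c.1.2 + 1 else 0) = k
      rw [hS1 c.2, hS c, hck]
      exact Nat.sub_add_cancel hk.1
    · change (if (c.1.1, c.1.2) ∈ μ then S c.1.1 c.1.2 + 1 else 0) - 1 = (f c : ℕ)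
      rw [hS1 c.2, hS c, Nat.add_sub_cancel]

/-- The coefficient `χ^μ(1^n)` is the number of standard Young tableaux of shape `μ`: both are the
coefficient of `x_1 ⋯ x_n` in the Schur polynomial. -/
theorem IsSchurPowerSumCoeff.apply_onesPartition_eq_card {n N : ℕ} {μ : YoungDiagram}
    {χ : n.Partition → ℚ} (hχ : IsSchurPowerSumCoeff N μ χ) (hμ : μ.card = n) (hN : n ≤ N) :
    χ (onesPartition n) = Nat.card (StandardYoungTableau μ) := by
  subst hμ
  rw [hχ.apply_onesPartition _ (card_initialLetters hN), coeff_schurPolynomial,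
    card_squarefreeFillings hN]

end

/-! ### Hooks and double hooks among all Young diagrams -/

theorem cells_hookDiagram {a b : ℕ} (h : 0 < a) :
    (hookDiagram a b h).cells = doubleHookCells a b 0 0 := by
  ext ⟨i, j⟩
  rw [YoungDiagram.mem_cells, hookDiagram, YoungDiagram.mem_ofRowLens, mem_doubleHookCells]
  rcases i with _ | i
  · simp
  · simp only [List.length_cons, List.length_replicate, List.getElem_cons_succ,
      List.getElem_replicate, exists_prop]
    omega

theorem cells_doubleHookDiagram {a b c d : ℕ} (hc : 1 ≤ c) (hca : c < a) (hdb : d < b) :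
    (doubleHookDiagram a b c d hc hca hdb).cells = doubleHookCells a b c d := by
  ext ⟨i, j⟩
  rw [YoungDiagram.mem_cells, doubleHookDiagram, YoungDiagram.mem_ofRowLens, mem_doubleHookCells]
  rcases i with _ | _ | i
  · simp
  · simp
    omega
  · simp only [List.length_cons, List.length_append, List.length_replicate,
      List.getElem_cons_succ, List.getElem_append, List.getElem_replicate, exists_prop]
    constructor
    · rintro ⟨h1, h2⟩
      split_ifs at h2 <;> omega
    · intro h
      refine ⟨by omega, ?_⟩
      split_ifs <;> omega

theorem mem_doubleHookDiagram {a b c d : ℕ} (hc : 1 ≤ c) (hca : c < a) (hdb : d < b) {i j : ℕ} :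
    (i, j) ∈ doubleHookDiagram a b c d hc hca hdb ↔ (i, j) ∈ doubleHookCells a b c d := by
  rw [← YoungDiagram.mem_cells, cells_doubleHookDiagram]

theorem eq_hookDiagram_of_notMem {μ : YoungDiagram} (h0 : (0, 0) ∈ μ) (h1 : (1, 1) ∉ μ) :
    ∃ (a b : ℕ) (ha : 0 < a), μ = hookDiagram a b ha := by
  have ha : 0 < μ.rowLen 0 := YoungDiagram.mem_iff_lt_rowLen.1 h0
  refine ⟨μ.rowLen 0, μ.colLen 0 - 1, ha, YoungDiagram.ext ?_⟩
  rw [cells_hookDiagram]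
  ext ⟨i, j⟩
  rw [mem_doubleHookCells, YoungDiagram.mem_cells]
  rcases i with _ | i
  · rw [YoungDiagram.mem_iff_lt_rowLen]
    omega
  · rcases j with _ | j
    · rw [YoungDiagram.mem_iff_lt_colLen]
      omega
    · refine iff_of_false (fun h => h1 (μ.up_left_mem ?_ ?_ h)) ?_ <;> omega

theorem eq_doubleHookDiagram_of_mem_of_notMem {μ : YoungDiagram} (h1 : (1, 1) ∈ μ)
    (h2 : (2, 2) ∉ μ) :
    ∃ (a b c d : ℕ) (hc : 1 ≤ c) (hca : c < a) (hdb : d < b),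
      μ = doubleHookDiagram a b c d hc hca hdb := by
  have hr := YoungDiagram.mem_iff_lt_rowLen.1 h1
  have hc := YoungDiagram.mem_iff_lt_colLen.1 h1
  have hr' := μ.rowLen_anti 0 1 zero_le_one
  have hc' := μ.colLen_anti 0 1 zero_le_one
  refine ⟨μ.rowLen 0, μ.colLen 0 - 1, μ.rowLen 1 - 1, μ.colLen 1 - 2, by omega, by omega, by omega,
    YoungDiagram.ext ?_⟩
  rw [cells_doubleHookDiagram]
  ext ⟨i, j⟩
  rw [mem_doubleHookCells, YoungDiagram.mem_cells]
  rcases i with _ | _ | i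
  · rw [YoungDiagram.mem_iff_lt_rowLen]
    omega
  · rw [zero_add, YoungDiagram.mem_iff_lt_rowLen]
    omega
  · rcases j with _ | _ | j
    · rw [YoungDiagram.mem_iff_lt_colLen]
      omega
    · rw [zero_add, YoungDiagram.mem_iff_lt_colLen]
      omega
    · refine iff_of_false (fun h => h2 (μ.up_left_mem ?_ ?_ h)) ?_ <;> omega

theorem card_standardYoungTableau_doubleHookDiagram {a b c d : ℕ} (hc : 1 ≤ c) (hca : c < a)
    (hdb : d < b) :
    (Nat.card (StandardYoungTableau (doubleHookDiagram a b c d hc hca hdb)) : ℚ) =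
      (Nat.multinomial Finset.univ ![a, b, c, d] : ℚ) * doubleHookRatio a b c d := by
  have hfac : ((a.factorial : ℚ) * b.factorial * c.factorial * d.factorial) *
      (Nat.multinomial Finset.univ ![a, b, c, d] : ℚ) = ((a + b + c + d).factorial : ℚ) := by
    have := Nat.multinomial_spec Finset.univ ![a, b, c, d]
    simp only [Fin.prod_univ_four, Fin.sum_univ_four] at this
    exact_mod_cast this
  have h0 : (a.factorial : ℚ) * b.factorial * c.factorial * d.factorial ≠ 0 := by positivity
  rw [Nat.card_congr (standardYoungTableauEquiv _), cells_doubleHookDiagram,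
    ← doubleHookCount, doubleHookCount_eq hc hca hdb, ← hfac, mul_div_cancel_left₀ _ h0]

/-! ### The value of `ρ` -/

theorem rowLen_eq_of_forall_mem_iff {μ : YoungDiagram} {i k : ℕ}
    (h : ∀ j, (i, j) ∈ μ ↔ j < k) : μ.rowLen i = k := by
  refine le_antisymm (le_of_not_gt fun hk => ?_) (le_of_not_gt fun hk => ?_)
  · exact lt_irrefl _ ((h k).1 (YoungDiagram.mem_iff_lt_rowLen.2 hk))
  · exact lt_irrefl _ (YoungDiagram.mem_iff_lt_rowLen.1 ((h _).2 hk))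

theorem colLen_eq_of_forall_mem_iff {μ : YoungDiagram} {j k : ℕ}
    (h : ∀ i, (i, j) ∈ μ ↔ i < k) : μ.colLen j = k := by
  refine le_antisymm (le_of_not_gt fun hk => ?_) (le_of_not_gt fun hk => ?_)
  · exact lt_irrefl _ ((h k).1 (YoungDiagram.mem_iff_lt_colLen.2 hk))
  · exact lt_irrefl _ (YoungDiagram.mem_iff_lt_colLen.1 ((h _).2 hk))

theorem sum_range_affine (m : ℕ) (x y : ℚ) :
    ∑ i ∈ Finset.range m, (x + y * i) = m * x + y * (m * (m - 1) / 2) := by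
  induction m with
  | zero => simp
  | succ m ih =>
    rw [Finset.sum_range_succ, ih]
    push_cast
    ring

theorem youngRho_doubleHookDiagram {a b c d : ℕ} (hc : 1 ≤ c) (hca : c < a) (hdb : d < b) :
    youngRho (doubleHookDiagram a b c d hc hca hdb) =
      (a.choose 2 : ℚ) - ((b + 1).choose 2 : ℚ) + (c.choose 2 : ℚ) - ((d + 1).choose 2 : ℚ) := by
  set μ := doubleHookDiagram a b c d hc hca hdb with hμ
  obtain ⟨e, rfl⟩ : ∃ e, b = d + e + 1 := ⟨b - d - 1, by omega⟩
  have hcol : μ.colLen 0 = d + e + 1 + 1 := colLen_eq_of_forall_mem_iff fun i => by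
    rw [hμ, mem_doubleHookDiagram, mem_doubleHookCells]
    omega
  have h0 : μ.rowLen 0 = a := rowLen_eq_of_forall_mem_iff fun j => by
    rw [hμ, mem_doubleHookDiagram, mem_doubleHookCells]
    omega
  have h1 : μ.rowLen 1 = c + 1 := rowLen_eq_of_forall_mem_iff fun j => by
    rw [hμ, mem_doubleHookDiagram, mem_doubleHookCells]
    omega
  have h2 : ∀ i ∈ Finset.range d, μ.rowLen (i + 1 + 1) = 2 := fun i hi =>
    rowLen_eq_of_forall_mem_iff fun j => by
      rw [hμ, mem_doubleHookDiagram, mem_doubleHookCells]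
      rw [Finset.mem_range] at hi
      omega
  have h3 : ∀ i ∈ Finset.range e, μ.rowLen (d + i + 1 + 1) = 1 := fun i hi =>
    rowLen_eq_of_forall_mem_iff fun j => by
      rw [hμ, mem_doubleHookDiagram, mem_doubleHookCells]
      rw [Finset.mem_range] at hi
      omega
  -- the rows split into the first two, the `d` rows of length `2` and the `e` rows of length `1`
  rw [youngRho, hcol, Finset.sum_range_succ', Finset.sum_range_succ', Finset.sum_range_add]
  have s2 : ∑ i ∈ Finset.range d, ((μ.rowLen (i + 1 + 1) : ℚ) *
      ((μ.rowLen (i + 1 + 1) : ℚ) - 2 * (((i + 1 + 1 : ℕ) : ℚ) + 1) + 1)) =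
      ∑ i ∈ Finset.range d, (-6 + -4 * (i : ℚ)) :=
    Finset.sum_congr rfl fun i hi => by
      rw [h2 i hi]
      push_cast
      ring
  have s3 : ∑ i ∈ Finset.range e, ((μ.rowLen (d + i + 1 + 1) : ℚ) *
      ((μ.rowLen (d + i + 1 + 1) : ℚ) - 2 * (((d + i + 1 + 1 : ℕ) : ℚ) + 1) + 1)) =
      ∑ i ∈ Finset.range e, ((-4 - 2 * d) + -2 * (i : ℚ)) :=
    Finset.sum_congr rfl fun i hi => by
      rw [h3 i hi]
      push_cast
      ring
  rw [s2, s3, sum_range_affine, sum_range_affine, zero_add, h0, h1, Nat.cast_choose_two,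
    Nat.cast_choose_two, Nat.cast_choose_two, Nat.cast_choose_two]
  push_cast
  ring

theorem mainTheorem7 (n : ℕ) :
    (∀ μ : YoungDiagram,
      (μ.card = n ∧ (0, 0) ∈ μ ∧ (1, 1) ∉ μ ↔
        ∃ (a b : ℕ) (ha : 0 < a), a + b = n ∧ μ = hookDiagram a b ha)) ∧
    (∀ μ : YoungDiagram,
      (μ.card = n ∧ (1, 1) ∈ μ ∧ (2, 2) ∉ μ ↔
        ∃ (a b c d : ℕ) (hc : 1 ≤ c) (hca : c < a) (hdb : d < b),
          a + b + c + d = n ∧ μ = doubleHookDiagram a b c d hc hca hdb)) ∧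
    (∀ (a b c d : ℕ) (hc : 1 ≤ c) (hca : c < a) (hdb : d < b), a + b + c + d = n →
      (Nat.card (StandardYoungTableau (doubleHookDiagram a b c d hc hca hdb)) : ℚ) =
          (Nat.multinomial Finset.univ ![a, b, c, d] : ℚ) *
            (((a : ℚ) * c * ((a : ℚ) - c) * ((b : ℚ) - d)) /
              (((a : ℚ) + b) * ((a : ℚ) + d) * ((b : ℚ) + c) * ((c : ℚ) + d))) ∧
      (∀ N : ℕ, n ≤ N → ∀ χ : n.Partition → ℚ,
        IsSchurPowerSumCoeff N (doubleHookDiagram a b c d hc hca hdb) χ →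
          χ (onesPartition n) =
            (Nat.multinomial Finset.univ ![a, b, c, d] : ℚ) *
              (((a : ℚ) * c * ((a : ℚ) - c) * ((b : ℚ) - d)) /
                (((a : ℚ) + b) * ((a : ℚ) + d) * ((b : ℚ) + c) * ((c : ℚ) + d)))) ∧
      youngRho (doubleHookDiagram a b c d hc hca hdb) =
        (a.choose 2 : ℚ) - ((b + 1).choose 2 : ℚ) + (c.choose 2 : ℚ) - ((d + 1).choose 2 : ℚ)) := by
  refine ⟨fun μ => ⟨?_, ?_⟩, fun μ => ⟨?_, ?_⟩, fun a b c d hc hca hdb h => ?_⟩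
  · rintro ⟨hn, h0, h1⟩
    obtain ⟨a, b, ha, rfl⟩ := eq_hookDiagram_of_notMem h0 h1
    rw [YoungDiagram.card, cells_hookDiagram, card_doubleHookCells] at hn
    exact ⟨a, b, ha, hn, rfl⟩
  · rintro ⟨a, b, ha, hn, rfl⟩
    rw [YoungDiagram.card, ← YoungDiagram.mem_cells, ← YoungDiagram.mem_cells, cells_hookDiagram,
      card_doubleHookCells, mem_doubleHookCells, mem_doubleHookCells]
    omega
  · rintro ⟨hn, h1, h2⟩
    obtain ⟨a, b, c, d, hc, hca, hdb, rfl⟩ := eq_doubleHookDiagram_of_mem_of_notMem h1 h2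
    rw [YoungDiagram.card, cells_doubleHookDiagram, card_doubleHookCells] at hn
    exact ⟨a, b, c, d, hc, hca, hdb, hn, rfl⟩
  · rintro ⟨a, b, c, d, hc, hca, hdb, hn, rfl⟩
    rw [YoungDiagram.card, ← YoungDiagram.mem_cells, ← YoungDiagram.mem_cells,
      cells_doubleHookDiagram, card_doubleHookCells, mem_doubleHookCells, mem_doubleHookCells]
    omega
  · have hcard : (doubleHookDiagram a b c d hc hca hdb).card = n := by
      rw [YoungDiagram.card, cells_doubleHookDiagram, card_doubleHookCells, h]
    refine ⟨card_standardYoungTableau_doubleHookDiagram hc hca hdb, fun N hN χ hχ => ?_,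
      youngRho_doubleHookDiagram hc hca hdb⟩
    rw [hχ.apply_onesPartition_eq_card hcard hN]
    exact card_standardYoungTableau_doubleHookDiagram hc hca hdb
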